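/- Let $k$ be a field of characteristic $0$ and let $R$ be a discrete valuation ring essentially of finite type over $k$, with uniformizer $\pi$ and fraction field $K$. Let $(X,D)\to\operatorname{Spec}R$ and $(X',D')\to\operatorname{Spec}R$ be flat proper families of pairs: $X$ and $X'$ are normal integral schemes, flat and proper over $R$ with geometrically integral fibres, and $D$, $D'$ are $\mathbb{Q}$-divisors whose supports contain no fibre. (For example, $\mathbb{Q}$-Gorenstein families of log Fano pairs.) Let $\alpha\colon X\dashrightarrow X'$ be a birational map over $R$ that induces an isomorphism $(X_K,D_K)\cong(X'_K,D'_K)$, and let $\rho\colon Y\to X$ and $\rho'\colon Y\to X'$ be proper birational morphisms over $R$ from a normal integral scheme $Y$ with $\alpha\circ\rho=\rho'$ as rational maps. Let $\widetilde X'_0$ be the birational transform on $Y$ of the special fibre $X'_0$ of $X'$. Let $K_X$, $K_{X'}$ and $K_Y$ be the canonical divisors (over $k$) defined by one and the same nonzero rational top differential form on $X$, $X'$ and $Y$, whose function fields are identified through $\alpha$ and $\rho$. Let $r$ be a positive integer such that $L:=-r(K_X+D)$ and $L':=-r(K_{X'}+D')$ are Cartier divisors. For $m\in\mathbb{N}$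 let $V_m:=H^0(X,\mathcal{O}_X(mL))\subseteq K(X)$, and let $V'_m:=H^0(X',\mathcal{O}_{X'}(mL'))$, viewed as a subset of $K(X)$ through $\alpha^*\colon K(X')\cong K(X)$. For $p\in\mathbb{Z}$ let $$\mathcal{F}^pV_m:=\{g\in V_m : g=0 \text{ or } \operatorname{ord}_{\widetilde X'_0}(g)\ge p\},$$ where $\operatorname{ord}_{\widetilde X'_0}(g)$ is the coefficient of $\widetilde X'_0$ in the divisor $\operatorname{div}(\rho^*g)$ of $\rho^*g$ as a section of $\rho^*\mathcal{O}_X(mL)$. Let $$a:=\operatorname{coeff}_{\widetilde X'_0}\bigl(K_Y-\rho^*(K_X+D)\bigr)$$ be the discrepancy of $\widetilde X'_0$ with respect to $(X,D)$. Then $ra$ is an integer, and for all $p\in\mathbb{Z}$ and $m\in\mathbb{N}$ $$\mathcal{F}^{\,p+mra}V_m=V_m\cap\pi^pV'_m .$$ -/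

import Mathlib

open AlgebraicGeometry CategoryTheory

universe u

namespace FamilyOfPairs

noncomputable section

/-! ### Rational top forms and their order along a discrete valuation -/

section Forms

open scoped KaehlerDifferential exteriorPower

/-- Rational differential forms of top degree of a field extension `F / k`, that is
`⋀^d Ω_{F/k}` with `d = dim_F Ω_{F/k}` (in characteristic zero `d` is the transcendence degree, for
finitely generated `F / k`). -/
abbrev RationalTopForm (k F : Type*) [Field k] [Field F] [Algebra k F] : Type _ :=
  ⋀[F]^(Module.finrank F (Ω[F⁄k])) (Ω[F⁄k])

variable (k : Type*) {F : Type*} [Field k] [Field F] [Algebra k F]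

/-- The top forms that are regular on a subring `A` of `F`: the `A`-span of the forms
`da₁ ∧ ⋯ ∧ da_d` with `aᵢ ∈ A`. This is the image of `⋀^d Ω_{A/k}` in `⋀^d Ω_{F/k}`. -/
def regularTopForms (A : Subring F) : Submodule A (RationalTopForm k F) :=
  Submodule.span A (Set.range fun a : Fin (Module.finrank F (Ω[F⁄k])) → A =>
    exteriorPower.ιMulti F (Module.finrank F (Ω[F⁄k]))
      (fun i => KaehlerDifferential.D k F (a i : F)))

/-- The order of vanishing of a rational top form `ω` with respect to a discrete valuation `v`
with valuation ring `A`: the largest `v t` such that `ω = t • η` with `η` regular on `A`. (If the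
module of regular top forms is free of rank one with generator `η₀` and `ω = t • η₀`, this is
`v t`.) -/
def formOrder (A : Subring F) (v : F → ℤ) (ω : RationalTopForm k F) : ℤ :=
  sSup {n : ℤ | ∃ t : F, t ≠ 0 ∧ ∃ η ∈ regularTopForms k A, ω = t • η ∧ n = v t}

end Forms

/-! ### Function fields and birational maps -/

section FunctionField

/-- The pullback of rational functions along a dominant morphism of integral schemes. -/
def functionFieldMap {Y X : Scheme.{u}} [IsIntegral Y] [IsIntegral X] (g : Y ⟶ X)
    [IsDominant g] : X.functionField →+* Y.functionField :=
  (X.presheaf.stalkSpecializes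
      (x := g (genericPoint Y)) (y := genericPoint X) (by
        have h := (genericPoint_spec Y).image g.continuous
        have h2 : closure (g '' Set.univ) = Set.univ := by
          rw [Set.image_univ]; exact g.denseRange.closure_range
        rw [h2] at h
        exact h.specializes trivial) ≫
    g.stalkMap (genericPoint Y)).hom

/-- A morphism (of integral schemes) is birational if it restricts to an isomorphism from a nonempty open subscheme of the source onto an open subscheme of
the target. -/
class IsBirationalMorphism {Y X : Scheme.{u}} (g : Y ⟶ X) : Prop where
  exists_isOpenImmersion : ∃ V : Y.Opens, Nonempty V ∧ IsOpenImmersion (V.ι ≫ g)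

instance IsBirationalMorphism.isDominant {Y X : Scheme.{u}} [IrreducibleSpace X] (g : Y ⟶ X)
    [IsBirationalMorphism g] : IsDominant g := by
  obtain ⟨V, ⟨v⟩, hV⟩ := IsBirationalMorphism.exists_isOpenImmersion (g := g)
  have ho : IsOpen (Set.range (V.ι ≫ g)) := (V.ι ≫ g).isOpenEmbedding.isOpen_range
  refine ⟨(ho.dense ⟨_, v, rfl⟩).mono ?_⟩
  rintro _ ⟨w, rfl⟩
  exact ⟨V.ι w, by simp⟩

/-- For a birational map `α : X ⇢ X'` between integral schemes, the induced isomorphism of function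
fields, in the direction `(α⁻¹)^* : K(X) → K(X')`: pull a rational function on `X` back along
`α⁻¹ : α.target ⟶ X`, and regard the result, which is a rational function on the open subscheme
`α.target` of `X'`, as a rational function on `X'`. -/
def inverseFunctionFieldMap {X X' : Scheme.{u}} [IsIntegral X] [IsIntegral X']
    (α : X.PartialIso X') : X.functionField →+* X'.functionField :=
  haveI _hne : Nonempty α.target := α.dense_target.nonempty.to_subtype
  haveI : IsIntegral α.target.toScheme := inferInstance
  haveI : IsDominant α.source.ι := Opens.isDominant_ι α.dense_source
  haveI : IsDominant (α.iso.inv ≫ α.source.ι) := inferInstance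
  haveI : IsIso (α.target.ι.stalkMap (genericPoint α.target.toScheme)) := inferInstance
  ((inv (α.target.ι.stalkMap (genericPoint α.target.toScheme)) ≫
      X'.presheaf.stalkSpecializes
        (specializes_of_eq (genericPoint_eq_of_isOpenImmersion α.target.ι).symm)).hom).comp
    (functionFieldMap (α.iso.inv ≫ α.source.ι))

end FunctionField

/-! ### Divisors -/

section Divisors

variable {X Y : Scheme.{u}} [IsIntegral X] [IsLocallyNoetherian X]
  [IsIntegral Y] [IsLocallyNoetherian Y]

/-- The rational function `h` is a local equation near `x` of the divisor whose coefficient at (the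
closure of) each point `z` of codimension one is `D z`. -/
def IsLocalEquation (D : X → ℚ) (x : X) (h : X.functionField) : Prop :=
  h ≠ 0 ∧ ∃ U : X.Opens, x ∈ U ∧ ∀ z ∈ U, Order.coheight z = 1 → (Scheme.ord h z : ℚ) = D z

/-- A divisor is Cartier if it has a local equation near every point. -/
def IsCartierDivisor (D : X → ℚ) : Prop :=
  ∀ x : X, ∃ h : X.functionField, IsLocalEquation D x h

open Classical in
/-- The coefficient at (the closure of) a point `y` of codimension one on `Y` of the pullback of a
`ℚ`-Cartier `ℚ`-divisor `D` along a dominant `ρ : Y ⟶ X`: if `h` is a local equation of `N D` near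
`ρ y`, with `N` a positive integer, it is `ord_y(ρ^* h) / N`. On a normal `X` this does not depend
on the choice of `N` and `h`. -/
def pullbackCoeff (ρ : Y ⟶ X) [IsDominant ρ] (D : X → ℚ) (y : Y) : ℚ :=
  if H : ∃ q : ℕ × X.functionField,
      0 < q.1 ∧ IsLocalEquation (fun z => (q.1 : ℚ) * D z) (ρ y) q.2 then
    (Scheme.ord (functionFieldMap ρ H.choose.2) y : ℚ) / (H.choose.1 : ℚ)
  else 0

/-! In the following definitions `F` is a field that is identified with the function field of `X`
through a ring homomorphism `φ`. This allows one to work with several birational models of `X` (and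
the same rational functions and forms) at once. -/

variable {F : Type*} [Field F] (φ : F →+* X.functionField)

/-- The local ring of `X` at `x`, as a subring of `F`. -/
def localSubring (x : X) : Subring F :=
  (algebraMap (X.presheaf.stalk x) X.functionField).range.comap φ

/-- The canonical divisor of `X` (over `k`) that is defined by the rational top form `ω`: its
coefficient at a point `x` of codimension one is the order of `ω` along `x`. -/
def canonicalDivisor (k : Type*) [Field k] [Algebra k F] (ω : RationalTopForm k F) (x : X) : ℤ :=
  formOrder k (localSubring φ x) (fun g => Scheme.ord (φ g) x) ω

/-- Global sections of `𝒪_X(D)`: the rational functions `g` with `g = 0` or `div g + D ≥ 0`. -/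
def globalSections (D : X → ℚ) : Set F :=
  {g | g ≠ 0 → ∀ z : X, Order.coheight z = 1 → 0 ≤ (Scheme.ord (φ g) z : ℚ) + D z}

end Divisors

/-! ### Families over a discrete valuation ring -/

section Families

variable {R : Type u} [CommRing R] [IsLocalRing R] {X : Scheme.{u}}

/-- The special fibre of `X → Spec R`, as a closed subset. -/
def specialFiber (f : X ⟶ Spec (CommRingCat.of R)) : Set X :=
  f ⁻¹' {IsLocalRing.closedPoint R}

/-- The function field `K(X)` of an integral scheme `X → Spec R`; a type synonym which carries the
algebra structure that is induced by the structure morphism. -/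
def FunctionField (_f : X ⟶ Spec (CommRingCat.of R)) [IsIntegral X] : Type u := X.functionField

variable (f : X ⟶ Spec (CommRingCat.of R)) [IsIntegral X]

instance : Field (FunctionField f) := inferInstanceAs (Field X.functionField)

/-- The tautological identification of `FunctionField f` with `X.functionField`. -/
def FunctionField.toFunctionField : FunctionField f →+* X.functionField :=
  RingHom.id X.functionField

/-- For a birational map `α : X ⇢ X'`, the identification `(α⁻¹)^*` of `K(X)` with `K(X')`. -/
def FunctionField.toFunctionFieldOfBirational {X' : Scheme.{u}} [IsIntegral X']
    (α : X.PartialIso X') : FunctionField f →+* X'.functionField :=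
  (inverseFunctionFieldMap α).comp (FunctionField.toFunctionField f)

/-- The structure map `R → K(X)`. -/
def FunctionField.structureMap : R →+* FunctionField f :=
  haveI : Nonempty (⊤ : X.Opens) := ⟨⟨genericPoint X, trivial⟩⟩
  ((Scheme.ΓSpecIso (CommRingCat.of R)).inv ≫ f.appTop ≫ X.germToFunctionField ⊤).hom

instance (k : Type*) [CommRing k] [Algebra k R] : Algebra k (FunctionField f) :=
  ((FunctionField.structureMap f).comp (algebraMap k R)).toAlgebra

/-- A flat proper family `f : X → Spec R` of pairs: `X` is normal, the geometric fibres of `f` are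
integral, and `D` is a `ℚ`-divisor on `X` whose support contains no fibre of `f`. The
`ℚ`-Gorenstein families of log Fano pairs are those for which moreover `f` is projective,
`K_X + D` is `ℚ`-Cartier, and the geometric fibres with the divisorial pullbacks of `D` are klt
pairs (in particular normal, with effective boundary) with ample `-(K + D)`. -/
structure IsFamilyOfPairs (D : AlgebraicCycle X ℚ) : Prop where
  flat : Flat f
  proper : IsProper f
  normal : ∀ x : X, IsIntegrallyClosed (X.presheaf.stalk x)
  geometricallyIntegral : GeometricallyIntegral f
  divisor : ∀ x : X, D x ≠ 0 → Order.coheight x = 1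
  fiber_not_subset : ∀ t : Spec (CommRingCat.of R), ¬ f ⁻¹' {t} ⊆ closure {x : X | D x ≠ 0}

end Families

/-- The birational (strict) transform on `Y` of a closed subset `Z` of `X` under a birational
morphism `ρ : Y ⟶ X`: the closure of the part of the preimage of `Z` that lies in the open set
where `ρ` is a local isomorphism. -/
def birationalTransform {Y X : Scheme.{u}} (ρ : Y ⟶ X) (Z : Set X) : Set Y :=
  closure {y | (∃ V : Y.Opens, y ∈ V ∧ IsOpenImmersion (V.ι ≫ ρ)) ∧ ρ y ∈ Z}

/-- `α : X ⇢ X'` is a birational map over `Spec R` that induces an isomorphism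
`(X_K, D_K) ≅ (X'_K, D'_K)` of the generic fibres (the complements of the special fibres). -/
structure IsGenericFiberIso {R : Type u} [CommRing R] [IsLocalRing R] {X X' : Scheme.{u}}
    (f : X ⟶ Spec (CommRingCat.of R)) (f' : X' ⟶ Spec (CommRingCat.of R))
    (D : AlgebraicCycle X ℚ) (D' : AlgebraicCycle X' ℚ) (α : X.PartialIso X') : Prop where
  isOver : α.IsOver f f'
  source_eq : (α.source : Set X) = (specialFiber f)ᶜ
  target_eq : (α.target : Set X') = (specialFiber f')ᶜ
  map_divisor : ∀ x : α.source.toScheme, D' (α.target.ι (α.iso.hom x)) = D (α.source.ι x)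

/-! ### The two filtrations -/

section Filtrations

variable {k : Type*} [Field k] {X Y : Scheme.{u}} [IsIntegral X] [IsLocallyNoetherian X]
  [IsIntegral Y] [IsLocallyNoetherian Y] {F : Type*} [Field F] [Algebra k F]

/-- The `ℚ`-divisor `K_X + D`, where `K_X` is defined by the rational top form `ω`. -/
def logCanonical (φ : F →+* X.functionField) (ω : RationalTopForm k F) (D : AlgebraicCycle X ℚ)
    (x : X) : ℚ :=
  (canonicalDivisor φ k ω x : ℚ) + D x

/-- The divisor `m L = - m r (K_X + D)`. -/
def antiLogCanonical (φ : F →+* X.functionField) (ω : RationalTopForm k F)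
    (D : AlgebraicCycle X ℚ) (r m : ℕ) (x : X) : ℚ :=
  -((m : ℚ) * (r : ℚ) * logCanonical φ ω D x)

/-- The order of vanishing along (the closure of) the point `E` of `Y` of a nonzero rational
function `g` as a section of `𝒪_X(D)`: the coefficient of `E` in the divisor of the section `ρ^* g`
of `ρ^* 𝒪_X(D)`, which is `div (ρ^* g) + ρ^* D`. -/
def sectionOrder (φ : F →+* X.functionField) (ρ : Y ⟶ X) [IsDominant ρ] (D : X → ℚ) (E : Y)
    (g : F) : ℚ :=
  (Scheme.ord (functionFieldMap ρ (φ g)) E : ℚ) + pullbackCoeff ρ D E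

/-- `V_m = H⁰(X, 𝒪_X(m L))` with `L = -r (K_X + D)`, as a set of rational functions. -/
def antiLogSections (φ : F →+* X.functionField) (ω : RationalTopForm k F) (D : AlgebraicCycle X ℚ)
    (r m : ℕ) : Set F :=
  globalSections φ (antiLogCanonical φ ω D r m)

/-- The filtration by order of vanishing along `E`: the global sections `g` of `𝒪_X(D)` with `g = 0`
or `ord_E g ≥ p`. -/
def vanishingFiltration (φ : F →+* X.functionField) (ρ : Y ⟶ X) [IsDominant ρ] (D : X → ℚ) (E : Y)
    (p : ℤ) : Set F :=
  {g | g ∈ globalSections φ D ∧ (g ≠ 0 → (p : ℚ) ≤ sectionOrder φ ρ D E g)}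

/-- The discrepancy `coeff_E (K_Y - ρ^*(K_X + D))`, where `K_Y` and `K_X` are defined by the same
rational top form. -/
def discrepancy (φ : F →+* X.functionField) (ω : RationalTopForm k F) (ρ : Y ⟶ X) [IsDominant ρ]
    (D : AlgebraicCycle X ℚ) (E : Y) : ℚ :=
  (canonicalDivisor ((functionFieldMap ρ).comp φ) k ω E : ℚ) -
    pullbackCoeff ρ (logCanonical φ ω D) E

end Filtrations

end

end FamilyOfPairs

open FamilyOfPairs

namespace FamilyOfPairs

/-! Let `E` be the generic point of the transform of `X'_0` on `Y`. Since `ρ'` is a local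
isomorphism at `E`, the local rings of `Y` at `E` and of `X'` at `ρ' E` agree. Hence `E` and `ρ' E`
give the same order on rational functions and the same canonical coefficient `κ`. The special fibre
is integral, so `π` is a uniformizer there, and `D'` has coefficient `0` there because its support
contains no fibre. So `mL'` has coefficient `-mrκ` along `X'_0`.

If `e` is the coefficient of `ρ^*L` at `E`, then `ra = rκ + e`, an integer because `L` is Cartier.
The order of `g` as a section of `mL` is `ord_E g + me`, so it is at least `p + mra` exactly when
`ord_{X'_0} g ≥ p + mrκ`. This says that `π^{-p} g` has no pole along `X'_0` as a section of `mL'`.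
At every other codimension one point of `X'` the element `π` is a unit and `X`, `X'` are isomorphic
as pairs, so the condition there follows from `g ∈ V_m`.

The main inputs are: pullback coefficients do not depend on the local equation (`pullbackCoeff_eq`,
resting on normality through `mem_range_algebraMap_of_forall_height_eq_one`); `π` generates the
maximal ideal at the generic point of `X'_0` (`maximalIdeal_stalk_eq_span`); and orders and
canonical coefficients depend only on the local ring (`ord_functionFieldMap`,
`canonicalDivisor_functionFieldMap`). -/

/-! ### Commutative algebra of normal domains and discrete valuation rings. -/

/-- A Noetherian integrally closed domain is the intersection of its localizations at the primes
of height one. -/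
theorem mem_range_algebraMap_of_forall_height_eq_one {A K : Type*} [CommRing A] [IsDomain A]
    [IsNoetherianRing A] [IsIntegrallyClosed A] [Field K] [Algebra A K] [IsFractionRing A K]
    (x : K)
    (hx : ∀ P : Ideal A, P.IsPrime → P.height = 1 →
      ∃ s : A, s ∉ P ∧ s • x ∈ (algebraMap A K).range) :
    x ∈ (algebraMap A K).range := by
  by_contra hxA
  let N : Submodule A K := LinearMap.range (Algebra.linearMap A K)
  have hmem : ∀ y : K, y ∈ N ↔ y ∈ (algebraMap A K).range := fun y => Iff.rfl
  have hx0 : (N.mkQ x : K ⧸ N) ≠ 0 := by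
    rw [Submodule.mkQ_apply, Ne, Submodule.Quotient.mk_eq_zero]
    exact hxA
  -- The annihilator of the class of `x` in `K / A` lies in an associated prime `P`, the annihilator
  -- of the class of some `z`. It suffices to show that `P` has height one.
  obtain ⟨P, hP, hle⟩ := exists_le_isAssociatedPrime_of_isNoetherianRing A _ hx0
  rw [isAssociatedPrime_iff] at hP
  obtain ⟨hPp, y, hy⟩ := hP
  obtain ⟨z, rfl⟩ := N.mkQ_surjective y
  have hmemP : ∀ s : A, s ∈ P ↔ s • z ∈ (algebraMap A K).range := fun s => by
    rw [hy, Submodule.mem_colon_singleton, Submodule.mem_bot, ← map_smul, Submodule.mkQ_apply,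
      Submodule.Quotient.mk_eq_zero, hmem]
  have hz : z ∉ (algebraMap A K).range := fun h => by
    apply hPp.ne_top
    rw [Ideal.eq_top_iff_one, hmemP, one_smul]
    exact h
  have hPbot : P ≠ ⊥ := by
    obtain ⟨a, b, hb, hab⟩ := IsFractionRing.div_surjective (A := A) z
    have hb0 : algebraMap A K b ≠ 0 := by
      simpa using nonZeroDivisors.ne_zero hb
    intro h
    refine nonZeroDivisors.ne_zero hb ?_
    rw [← Ideal.mem_bot, ← h, hmemP]
    refine ⟨a, ?_⟩
    rw [← hab, Algebra.smul_def]
    field_simp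
  have hinj := IsFractionRing.injective A K
  -- Otherwise `zP ⊆ P` with `P` nonzero and finitely generated, so `z` is integral over `A` by the
  -- determinant trick, hence in `A`.
  obtain ⟨t, htP, s, hsP, hts⟩ : ∃ t ∈ P, ∃ s, s ∉ P ∧ algebraMap A K s = t • z := by
    by_contra! H
    apply hz
    have hint : IsIntegral A z := by
      refine isIntegral_of_smul_mem_submodule (Submodule.map (Algebra.linearMap A K) P) ?_ ?_ z ?_
      · intro h
        exact hPbot (Submodule.map_injective_of_injective (f := Algebra.linearMap A K) hinj
          (h.trans (Submodule.map_bot _).symm))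
      · exact (IsNoetherian.noetherian P).map _
      · rintro _ ⟨q, hq, rfl⟩
        obtain ⟨s, hs⟩ := (hmemP q).1 hq
        refine ⟨s, ?_, ?_⟩
        · by_contra h
          exact H q hq s h hs
        · simp [hs, Algebra.smul_def, mul_comm]
    exact (IsIntegrallyClosed.isIntegral_iff).1 hint
  -- For `q ∈ P` the product `w = qz` lies in `A` and `sq = wt`. A prime inside `P` that contains
  -- `t` therefore contains `q`, as `s ∉ P`. Krull's principal ideal theorem then bounds the height.
  have hmin : P ∈ (Ideal.span {t}).minimalPrimes := by
    refine ⟨⟨hPp, (Ideal.span_singleton_le_iff_mem _).2 htP⟩, ?_⟩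
    rintro Q ⟨hQ, htQ⟩ hQP q hq
    obtain ⟨w, hw⟩ := (hmemP q).1 hq
    have hsq : s * q = w * t := by
      apply hinj
      rw [map_mul, map_mul, hts, hw]
      simp only [Algebra.smul_def]
      ring
    have : s * q ∈ Q := hsq ▸ Q.mul_mem_left _ ((Ideal.span_singleton_le_iff_mem _).1 htQ)
    exact (hQ.mem_or_mem this).resolve_left fun h => hsP (hQP h)
  have hle1 : P.height ≤ 1 := Ideal.height_le_one_of_isPrincipal_of_mem_minimalPrimes _ _ hmin
  have hne0 : P.height ≠ 0 := fun h => hPbot (by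
    rw [Ideal.height_eq_zero_iff, IsDomain.minimalPrimes_eq_singleton_bot] at h
    exact h)
  obtain ⟨s', hs', hs'x⟩ := hx P hPp (le_antisymm hle1 (Order.one_le_iff_ne_zero.2 hne0))
  apply hs'
  apply hle
  rw [Submodule.mem_colon_singleton, Submodule.mem_bot, ← map_smul, Submodule.mkQ_apply,
      Submodule.Quotient.mk_eq_zero, hmem]
  exact hs'x

/-- The order of vanishing on the fraction field is compatible with isomorphisms of discrete
valuation rings. -/
theorem ordFrac_map_of_bijective {A B K L : Type*} [CommRing A] [CommRing B] [IsDomain A]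
    [IsDomain B] [IsDiscreteValuationRing A] [IsDiscreteValuationRing B] [Field K] [Field L]
    [Algebra A K] [Algebra B L] [IsFractionRing A K] [IsFractionRing B L]
    (σ : A →+* B) (hσ : Function.Bijective σ) (τ : K →+* L)
    (hστ : ∀ a, τ (algebraMap A K a) = algebraMap B L (σ a)) (x : K) :
    Ring.ordFrac B (τ x) = Ring.ordFrac A x := by
  -- A nonzero element of `A` is a unit times a power of a uniformizer, and `σ` preserves both units
  -- and uniformizers.
  have key : ∀ a : A, a ≠ 0 → Ring.ordFrac B (τ (algebraMap A K a)) =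
      Ring.ordFrac A (algebraMap A K a) := by
    intro a ha
    obtain ⟨ϖ, hϖ⟩ := IsDiscreteValuationRing.exists_irreducible A
    obtain ⟨n, u, rfl⟩ := IsDiscreteValuationRing.eq_unit_mul_pow_irreducible ha hϖ
    have hϖ' : Irreducible (σ ϖ) :=
      (MulEquiv.irreducible_iff (RingEquiv.ofBijective σ hσ)).2 hϖ
    rw [hστ]
    simp only [map_mul, map_pow]
    rw [Ring.ordFrac_irreducible hϖ, Ring.ordFrac_irreducible hϖ',
      Ring.ordFrac_of_isUnit u.isUnit, Ring.ordFrac_of_isUnit (u.isUnit.map σ)]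
  by_cases hx : x = 0
  · simp [hx]
  obtain ⟨a, b, hb, rfl⟩ := IsFractionRing.div_surjective (A := A) x
  have ha : a ≠ 0 := by rintro rfl; simp at hx
  rw [map_div₀, map_div₀, map_div₀, key a ha, key b (nonZeroDivisors.ne_zero hb)]

/-! ### Pullback of rational functions. -/

section FunctionField

variable {X Y Z : Scheme.{u}} [IsIntegral X] [IsIntegral Y] [IsIntegral Z]

/-- Stalk maps commute with specialization; this reduces questions about function fields to local
rings. -/
theorem functionFieldMap_algebraMap (g : Y ⟶ X) [IsDominant g] (y : Y)
    (a : X.presheaf.stalk (g y)) :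
    functionFieldMap g (algebraMap (X.presheaf.stalk (g y)) X.functionField a) =
      algebraMap (Y.presheaf.stalk y) Y.functionField (g.stalkMap y a) := by
  have h : genericPoint Y ⤳ y := (genericPoint_spec Y).specializes trivial
  refine Eq.trans ?_ (g.stalkSpecializes_stalkMap_apply _ _ h a)
  refine congrArg (g.stalkMap (genericPoint Y)) ?_
  exact congr($(X.presheaf.stalkSpecializes_comp _ _).hom a)

theorem functionFieldMap_comp (g : Y ⟶ X) (h : X ⟶ Z) [IsDominant g] [IsDominant h] :
    functionFieldMap (g ≫ h) = (functionFieldMap g).comp (functionFieldMap h) := by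
  let y := genericPoint Y
  refine IsLocalization.ringHom_ext (nonZeroDivisors (Z.presheaf.stalk (h (g y)))) ?_
  ext a
  simp only [RingHom.comp_apply]
  rw [functionFieldMap_algebraMap h (g y), functionFieldMap_algebraMap g y]
  refine (functionFieldMap_algebraMap (g ≫ h) y a).trans ?_
  rw [Scheme.Hom.stalkMap_comp]
  rfl

theorem functionFieldMap_congr {g h : Y ⟶ X} [IsDominant g] [IsDominant h] (e : g = h) :
    functionFieldMap g = functionFieldMap h := by
  subst e; rfl

/-- The pullback of the rational function defined by a global function. -/
theorem functionFieldMap_germToFunctionField (g : Y ⟶ X) [IsDominant g]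
    [Nonempty (⊤ : X.Opens)] [Nonempty (⊤ : Y.Opens)] (s : Γ(X, ⊤)) :
    functionFieldMap g (X.germToFunctionField ⊤ s) = Y.germToFunctionField ⊤ (g.appTop s) := by
  let y := genericPoint Y
  rw [← Scheme.algebraMap_germ_eq_germToFunctionField X (U := ⊤) (x := g y) trivial,
    functionFieldMap_algebraMap,
    ← Scheme.algebraMap_germ_eq_germToFunctionField Y (U := ⊤) (x := y) trivial]
  refine congrArg _ ?_
  exact Scheme.Hom.germ_stalkMap_apply g ⊤ y trivial s

/-- The specialization maps between the two equal generic points cancel. This property determines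
`inverseFunctionFieldMap`, since pullback to the open target is injective. -/
theorem functionFieldMap_inverseFunctionFieldMap {X' : Scheme.{u}} [IsIntegral X']
    (α : X.PartialIso X') [IsIntegral α.target.toScheme] [IsDominant α.target.ι]
    [IsDominant (α.iso.inv ≫ α.source.ι)] (x : X.functionField) :
    functionFieldMap α.target.ι (inverseFunctionFieldMap α x) =
      functionFieldMap (α.iso.inv ≫ α.source.ι) x := by
  set i := α.target.ι with hi
  have hiso : IsIso (i.stalkMap (genericPoint α.target.toScheme)) := inferInstance
  let y : α.target.toScheme.functionField := functionFieldMap (α.iso.inv ≫ α.source.ι) x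
  have h := specializes_of_eq (genericPoint_eq_of_isOpenImmersion i)
  have key : inv (i.stalkMap (genericPoint α.target.toScheme)) ≫
      X'.presheaf.stalkSpecializes
        (specializes_of_eq (genericPoint_eq_of_isOpenImmersion i).symm) ≫
      X'.presheaf.stalkSpecializes h ≫ i.stalkMap (genericPoint α.target.toScheme) = 𝟙 _ := by
    rw [X'.presheaf.stalkSpecializes_comp_assoc, X'.presheaf.stalkSpecializes_refl,
      Category.id_comp, IsIso.inv_hom_id]
  exact congr($(key).hom y)

end FunctionField

/-! ### Invariants of a point that depend only on its local ring. -/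

section Transport

variable {X Y : Scheme.{u}}

theorem coheight_eq_of_bijective_stalkMap (g : Y ⟶ X) (y : Y)
    (hg : Function.Bijective (g.stalkMap y)) : Order.coheight (g y) = Order.coheight y := by
  have h := ringKrullDim_eq_of_ringEquiv (RingEquiv.ofBijective (g.stalkMap y).hom hg)
  rw [ringKrullDim_stalk_eq_coheight, ringKrullDim_stalk_eq_coheight] at h
  exact WithBot.coe_injective h

variable [IsIntegral X] [IsIntegral Y] {F : Type*} [Field F] (φ : F →+* X.functionField)

theorem localSubring_functionFieldMap (g : Y ⟶ X) [IsDominant g] (y : Y)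
    (hg : Function.Bijective (g.stalkMap y)) :
    localSubring ((functionFieldMap g).comp φ) y = localSubring φ (g y) := by
  ext t
  constructor
  · rintro ⟨b, hb⟩
    obtain ⟨a, rfl⟩ := hg.2 b
    refine ⟨a, (functionFieldMap g).injective ?_⟩
    rw [functionFieldMap_algebraMap]
    exact hb
  · rintro ⟨a, ha⟩
    refine ⟨g.stalkMap y a, ?_⟩
    rw [← functionFieldMap_algebraMap, ha]
    rfl

end Transport

/-! ### Orders of vanishing and canonical coefficients at points of codimension one. -/

section Order

variable {X Y : Scheme.{u}} [IsIntegral X] [IsIntegral Y] [IsLocallyNoetherian X]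
  [IsLocallyNoetherian Y]

theorem isDiscreteValuationRing_stalk (x : X) (hx : Order.coheight x = 1)
    (hn : IsIntegrallyClosed (X.presheaf.stalk x)) :
    IsDiscreteValuationRing (X.presheaf.stalk x) := by
  have hdim : ringKrullDim (X.presheaf.stalk x) = 1 := by
    rw [ringKrullDim_stalk_eq_coheight, hx]; rfl
  have hf : ¬ IsField (X.presheaf.stalk x) := fun h => by
    rw [ringKrullDim_eq_zero_of_isField h] at hdim
    exact zero_ne_one hdim
  have : Ring.KrullDimLE 1 (X.presheaf.stalk x) := Ring.krullDimLE_iff.2 hdim.le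
  have h := (IsDiscreteValuationRing.TFAE (X.presheaf.stalk x) hf).out 0 3
  refine h.2 ⟨hn, IsLocalRing.maximalIdeal _, ⟨?_, inferInstance⟩, ?_⟩
  · exact fun h => hf (IsLocalRing.isField_iff_maximalIdeal_eq.2 h)
  · rintro P ⟨hP, hPp⟩
    exact IsLocalRing.eq_maximalIdeal
      (Ring.krullDimLE_one_iff_of_noZeroDivisors.1 this P hP hPp)

theorem ord_algebraMap_of_isUnit (x : X) (a : X.presheaf.stalk x) (ha : IsUnit a) :
    Scheme.ord (algebraMap (X.presheaf.stalk x) X.functionField a) x = 0 := by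
  by_cases hx : Order.coheight x = 1
  · have : Ring.KrullDimLE 1 (X.presheaf.stalk x) := krullDimLE_of_coheight_le hx.le
    rw [Scheme.ord_eq_iff hx]
    · exact Ring.ordFrac_of_isUnit ha
    · simpa using ha.ne_zero
  · exact Scheme.ord_eq_zero_of_coheight_neq_one hx _

theorem ord_algebraMap_of_irreducible (x : X) (hx : Order.coheight x = 1)
    [IsDiscreteValuationRing (X.presheaf.stalk x)] (a : X.presheaf.stalk x) (ha : Irreducible a) :
    Scheme.ord (algebraMap (X.presheaf.stalk x) X.functionField a) x = 1 := by
  rw [Scheme.ord_eq_iff hx]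
  · exact Ring.ordFrac_irreducible ha
  · simpa using ha.ne_zero

theorem mem_range_algebraMap_of_ord_eq_zero (x : X) (hx : Order.coheight x = 1)
    (hn : IsIntegrallyClosed (X.presheaf.stalk x)) (h : X.functionField) (h0 : h ≠ 0)
    (hord : Scheme.ord h x = 0) :
    h ∈ (algebraMap (X.presheaf.stalk x) X.functionField).range := by
  have := isDiscreteValuationRing_stalk x hx hn
  rw [Scheme.ord_eq_iff hx h0] at hord
  have h1 : Ring.ordFrac (X.presheaf.stalk x) (1 : X.functionField) =
    Ring.ordFrac (X.presheaf.stalk x) h := by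
    rw [map_one]; exact hord.symm
  obtain ⟨u, hu⟩ := Ring.associated_of_ordFrac_eq _ _ h1
  exact ⟨u, by rw [← hu, Units.smul_def, Algebra.smul_def, mul_one]⟩

theorem ord_inv (x : X) {h : X.functionField} (h0 : h ≠ 0) :
    Scheme.ord h⁻¹ x = - Scheme.ord h x := by
  have h1 : Scheme.ord (h * h⁻¹) x = 0 := by
    rw [mul_inv_cancel₀ h0]
    simpa using ord_algebraMap_of_isUnit x 1 isUnit_one
  rw [Scheme.ord_mul h0 (inv_ne_zero h0)] at h1
  linarith

theorem ord_one (x : X) : Scheme.ord (1 : X.functionField) x = 0 := by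
  simpa using ord_algebraMap_of_isUnit x 1 isUnit_one

theorem ord_pow (x : X) {h : X.functionField} (h0 : h ≠ 0) (n : ℕ) :
    Scheme.ord (h ^ n) x = n * Scheme.ord h x := by
  induction n with
  | zero => simpa using ord_one x
  | succ n ih => rw [pow_succ, Scheme.ord_mul (pow_ne_zero _ h0) h0, ih]; push_cast; ring

theorem ord_zpow (x : X) {h : X.functionField} (h0 : h ≠ 0) (n : ℤ) :
    Scheme.ord (h ^ n) x = n * Scheme.ord h x := by
  obtain ⟨n, rfl | rfl⟩ := n.eq_nat_or_neg
  · rw [zpow_natCast, ord_pow x h0]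
  · rw [zpow_neg, zpow_natCast, ord_inv x (pow_ne_zero _ h0), ord_pow x h0]; ring

/-! ### Transport along a morphism that is an isomorphism on a stalk -/

theorem ord_functionFieldMap (g : Y ⟶ X) [IsDominant g] (y : Y)
    (hg : Function.Bijective (g.stalkMap y))
    (hn : IsIntegrallyClosed (X.presheaf.stalk (g y))) (h : X.functionField) :
    Scheme.ord (functionFieldMap g h) y = Scheme.ord h (g y) := by
  have hc := coheight_eq_of_bijective_stalkMap g y hg
  by_cases h0 : h = 0
  · simp [h0]
  by_cases hy : Order.coheight y = 1
  · have hx := hc.trans hy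
    have := isDiscreteValuationRing_stalk (g y) hx hn
    have hn' : IsIntegrallyClosed (Y.presheaf.stalk y) :=
      IsIntegrallyClosed.of_equiv (RingEquiv.ofBijective (g.stalkMap y).hom hg)
    have := isDiscreteValuationRing_stalk y hy hn'
    rw [Scheme.ord_eq_iff hy ((map_ne_zero _).2 h0)]
    have h1 := (Scheme.ord_eq_iff hx h0).1 rfl
    rw [← h1]
    exact ordFrac_map_of_bijective (g.stalkMap y).hom hg (functionFieldMap g)
      (functionFieldMap_algebraMap g y) h
  · rw [Scheme.ord_eq_zero_of_coheight_neq_one hy,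
      Scheme.ord_eq_zero_of_coheight_neq_one (by rwa [hc])]

variable {F : Type*} [Field F] (φ : F →+* X.functionField)

/-- The order of a form is defined from the local subring and its order function alone, and neither
changes under an isomorphism of stalks. -/
theorem canonicalDivisor_functionFieldMap {k : Type*} [Field k] [Algebra k F]
    (ω : RationalTopForm k F) (g : Y ⟶ X) [IsDominant g] (y : Y)
    (hg : Function.Bijective (g.stalkMap y))
    (hn : IsIntegrallyClosed (X.presheaf.stalk (g y))) :
    canonicalDivisor ((functionFieldMap g).comp φ) k ω y = canonicalDivisor φ k ω (g y) := by
  rw [canonicalDivisor, canonicalDivisor, localSubring_functionFieldMap φ g y hg]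
  congr 1
  ext t
  exact ord_functionFieldMap g y hg hn _

end Order

/-! ### Local equations and pullback of `ℚ`-Cartier divisors on normal schemes. -/

section Pullback

variable {X Y : Scheme.{u}} [IsIntegral X] [IsIntegral Y] [IsLocallyNoetherian X]
  [IsLocallyNoetherian Y]

/-- On a normal scheme, a rational function without zeros and poles near `x` is regular at `x`. -/
theorem mem_range_algebraMap_of_forall_ord_eq_zero
    (hn : ∀ x : X, IsIntegrallyClosed (X.presheaf.stalk x)) (x : X) (U : X.Opens) (hx : x ∈ U)
    (h : X.functionField) (h0 : h ≠ 0)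
    (hord : ∀ z ∈ U, Order.coheight z = 1 → Scheme.ord h z = 0) :
    h ∈ (algebraMap (X.presheaf.stalk x) X.functionField).range := by
  obtain ⟨_, ⟨V, hV, rfl⟩, hxV, hVU⟩ :=
    X.isBasis_affineOpens.exists_subset_of_mem_open hx U.isOpen
  have hV : IsAffineOpen V := hV
  have : Nonempty V := ⟨⟨x, hxV⟩⟩
  have := hn x
  refine mem_range_algebraMap_of_forall_height_eq_one h fun P hP hP1 => ?_
  let ψ : Γ(X, V) →+* X.presheaf.stalk x := (X.presheaf.germ V x hxV).hom
  -- A height one prime of the stalk at `x` contracts to a codimension one point of `V`, where the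
  -- hypothesis on orders applies.
  let q : PrimeSpectrum Γ(X, V) := ⟨P.comap ψ, hP.comap ψ⟩
  let q' : Spec Γ(X, V) := q
  have hzV : hV.fromSpec q' ∈ V := by
    have : hV.fromSpec q' ∈ Set.range hV.fromSpec := ⟨_, rfl⟩
    rwa [hV.range_fromSpec] at this
  have hz1 : Order.coheight (hV.fromSpec q') = 1 := by
    refine (coheight_eq_of_isOpenImmersion (x := q') hV.fromSpec).trans ?_
    rw [← idealHeight_eq_coheight]
    let _ : Algebra Γ(X, V) (X.presheaf.stalk x) := ψ.toAlgebra
    have : IsLocalization.AtPrime (X.presheaf.stalk x) (hV.primeIdealOf ⟨x, hxV⟩).asIdeal :=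
      hV.isLocalization_stalk ⟨x, hxV⟩
    rw [← hP1]
    exact IsLocalization.height_under (hV.primeIdealOf ⟨x, hxV⟩).asIdeal.primeCompl P
  obtain ⟨a, ha⟩ := mem_range_algebraMap_of_ord_eq_zero _ hz1 (hn _) h h0 (hord _ (hVU hzV) hz1)
  let _ : Algebra Γ(X, V) (X.presheaf.stalk (hV.fromSpec q')) :=
    (X.presheaf.germ V _ hzV).hom.toAlgebra
  have : IsLocalization.AtPrime (X.presheaf.stalk (hV.fromSpec q')) q.asIdeal :=
    hV.isLocalization_stalk' q' hzV
  -- Thus `h = b / s` with `s ∉ q`; as `q` is the contraction of `P`, the germ of `s` avoids `P`.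
  obtain ⟨⟨b, s⟩, hbs⟩ := IsLocalization.surj q.asIdeal.primeCompl a
  refine ⟨ψ s, s.2, ψ b, ?_⟩
  have h1 := congrArg (algebraMap _ X.functionField) hbs
  rw [map_mul, ha] at h1
  rw [Algebra.smul_def, mul_comm]
  have h2 : ∀ c : Γ(X, V), algebraMap (X.presheaf.stalk x) X.functionField (ψ c) =
      algebraMap (X.presheaf.stalk (hV.fromSpec q')) X.functionField
        (algebraMap Γ(X, V) _ c) := fun c =>
    (Scheme.algebraMap_germ_eq_germToFunctionField X hxV c).trans
      (Scheme.algebraMap_germ_eq_germToFunctionField X hzV c).symm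
  rw [h2, h2]
  exact h1.symm

theorem IsLocalEquation.inv {D : X → ℚ} {x : X} {h : X.functionField}
    (hD : IsLocalEquation D x h) : IsLocalEquation (fun z => -D z) x h⁻¹ := by
  obtain ⟨h0, U, hx, hU⟩ := hD
  refine ⟨inv_ne_zero h0, U, hx, fun z hz hz1 => ?_⟩
  rw [ord_inv z h0, Int.cast_neg, hU z hz hz1]

theorem IsLocalEquation.pow {D : X → ℚ} {x : X} {h : X.functionField}
    (hD : IsLocalEquation D x h) (n : ℕ) : IsLocalEquation (fun z => n * D z) x (h ^ n) := by
  obtain ⟨h0, U, hx, hU⟩ := hD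
  refine ⟨pow_ne_zero _ h0, U, hx, fun z hz hz1 => ?_⟩
  rw [ord_pow z h0, Int.cast_mul, hU z hz hz1, Int.cast_natCast]

/-- The quotient of the two equations and its inverse are both regular at `ρ y` by normality, so the
quotient is a unit there and pulls back to a unit at `y`. -/
theorem IsLocalEquation.ord_functionFieldMap_eq
    (hn : ∀ x : X, IsIntegrallyClosed (X.presheaf.stalk x)) (ρ : Y ⟶ X) [IsDominant ρ] (y : Y)
    {D : X → ℚ} {h h' : X.functionField} (hD : IsLocalEquation D (ρ y) h)
    (hD' : IsLocalEquation D (ρ y) h') :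
    Scheme.ord (functionFieldMap ρ h) y = Scheme.ord (functionFieldMap ρ h') y := by
  obtain ⟨h0, U, hx, hU⟩ := hD
  obtain ⟨h0', U', hx', hU'⟩ := hD'
  have hq : ∀ z ∈ U ⊓ U', Order.coheight z = 1 → Scheme.ord (h * h'⁻¹) z = 0 := by
    intro z hz hz1
    have h1 := hU z hz.1 hz1
    rw [← hU' z hz.2 hz1, Int.cast_inj] at h1
    rw [Scheme.ord_mul h0 (inv_ne_zero h0'), ord_inv z h0', h1, add_neg_cancel]
  have hne : h * h'⁻¹ ≠ 0 := mul_ne_zero h0 (inv_ne_zero h0')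
  obtain ⟨a, ha⟩ := mem_range_algebraMap_of_forall_ord_eq_zero hn (ρ y) (U ⊓ U') ⟨hx, hx'⟩ _ hne hq
  obtain ⟨b, hb⟩ := mem_range_algebraMap_of_forall_ord_eq_zero hn (ρ y) (U ⊓ U') ⟨hx, hx'⟩ _
    (inv_ne_zero hne) fun z hz hz1 => by rw [ord_inv z hne, hq z hz hz1, neg_zero]
  have hab : a * b = 1 := by
    apply IsFractionRing.injective (X.presheaf.stalk (ρ y)) X.functionField
    rw [map_mul, ha, hb, map_one, mul_inv_cancel₀ hne]
  have hu := ord_algebraMap_of_isUnit y (ρ.stalkMap y a)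
    ((IsUnit.of_mul_eq_one b hab).map (ρ.stalkMap y).hom)
  rw [← functionFieldMap_algebraMap, ha, map_mul, map_inv₀, Scheme.ord_mul, ord_inv] at hu
  · linarith
  · simpa using h0'
  · simpa using h0
  · simpa using h0'

/-- The pullback of a `ℚ`-Cartier divisor can be computed with any local equation. -/
theorem pullbackCoeff_eq
    (hn : ∀ x : X, IsIntegrallyClosed (X.presheaf.stalk x)) (ρ : Y ⟶ X) [IsDominant ρ] (y : Y)
    {D : X → ℚ} {N : ℕ} (hN : 0 < N) {h : X.functionField}
    (hD : IsLocalEquation (fun z => (N : ℚ) * D z) (ρ y) h) :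
    pullbackCoeff ρ D y = (Scheme.ord (functionFieldMap ρ h) y : ℚ) / N := by
  have H : ∃ q : ℕ × X.functionField,
      0 < q.1 ∧ IsLocalEquation (fun z => (q.1 : ℚ) * D z) (ρ y) q.2 := ⟨(N, h), hN, hD⟩
  rw [pullbackCoeff, dif_pos H]
  obtain ⟨hN', hD'⟩ := H.choose_spec
  set M := H.choose.1
  set h' := H.choose.2
  -- `h ^ M` and `h' ^ N` are local equations of the same divisor `MN D`.
  have e1 := hD.pow M
  have e2 := hD'.pow N
  have e3 : (fun z => (N : ℚ) * ((M : ℚ) * D z)) = fun z => (M : ℚ) * ((N : ℚ) * D z) := by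
    ext z; ring
  rw [e3] at e2
  have key := IsLocalEquation.ord_functionFieldMap_eq hn ρ y e1 e2
  rw [map_pow, map_pow, ord_pow y ((map_ne_zero _).2 hD.1),
    ord_pow y ((map_ne_zero _).2 hD'.1)] at key
  have key' : (M : ℚ) * (Scheme.ord (functionFieldMap ρ h) y : ℚ) =
    N * (Scheme.ord (functionFieldMap ρ h') y : ℚ) := by exact_mod_cast key
  have hNq : (N : ℚ) ≠ 0 := by exact_mod_cast hN.ne'
  have hMq : (M : ℚ) ≠ 0 := by exact_mod_cast hN'.ne'
  rw [div_eq_div_iff hMq hNq]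
  linarith

end Pullback

/-! ### The uniformizer of the base along the special fibre. -/

section SpecialFiber

open Limits TensorProduct

variable {R : Type u} [CommRing R] {X : Scheme.{u}} (f : X ⟶ Spec (CommRingCat.of R))

/-- The global function on a scheme over `Spec R` that is defined by an element of `R`. -/
noncomputable def globalFunction (a : R) : Γ(X, ⊤) :=
  f.appTop ((Scheme.ΓSpecIso (CommRingCat.of R)).inv a)

theorem isUnit_germ_globalFunction_iff (a : R) (x : X) :
    IsUnit (X.presheaf.germ ⊤ x trivial (globalFunction f a)) ↔
      a ∉ PrimeSpectrum.asIdeal (f x) := by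
  rw [← Scheme.mem_basicOpen_top, globalFunction, ← Scheme.preimage_basicOpen_top,
    basicOpen_eq_of_affine]
  rfl

theorem globalFunction_comp {Y : Scheme.{u}} (g : Y ⟶ X) (a : R) :
    globalFunction (g ≫ f) a = g.appTop (globalFunction f a) := by
  rw [globalFunction, globalFunction, Scheme.Hom.comp_appTop]
  rfl

variable [IsDomain R] [IsDiscreteValuationRing R] {π : R} (hπ : Irreducible π)

include hπ in
theorem eq_closedPoint_iff (p : PrimeSpectrum R) :
    p = IsLocalRing.closedPoint R ↔ π ∈ p.asIdeal := by
  rw [IsLocalRing.closedPoint, PrimeSpectrum.ext_iff]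
  simp only
  rw [hπ.maximalIdeal_eq]
  refine ⟨fun h => h ▸ Ideal.mem_span_singleton_self π, fun h => ?_⟩
  have hle : IsLocalRing.maximalIdeal R ≤ p.asIdeal := by
    rw [hπ.maximalIdeal_eq]
    exact (Ideal.span_singleton_le_iff_mem _).2 h
  rw [← hπ.maximalIdeal_eq]
  exact ((IsLocalRing.maximalIdeal.isMaximal R).eq_of_le p.2.ne_top hle).symm

include hπ in
theorem mem_specialFiber_iff (x : X) :
    x ∈ specialFiber f ↔ ¬ IsUnit (X.presheaf.germ ⊤ x trivial (globalFunction f π)) := by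
  rw [isUnit_germ_globalFunction_iff, not_not]
  exact eq_closedPoint_iff hπ (f x)

theorem isClosed_specialFiber : IsClosed (specialFiber f) :=
  (IsLocalRing.isClosed_singleton_closedPoint R).preimage f.continuous

/-- The special fibre of a geometrically integral family has a generic point. -/
theorem exists_isGenericPoint_specialFiber [GeometricallyIntegral f] :
    ∃ ξ : X, IsGenericPoint ξ (specialFiber f) := by
  let s : Spec (CommRingCat.of R) := IsLocalRing.closedPoint R
  refine ⟨f.fiberι s (genericPoint (f.fiber s)), ?_⟩
  have h := (genericPoint_spec (f.fiber s)).image (f.fiberι s).continuous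
  rw [Set.image_univ, Scheme.Hom.range_fiberι] at h
  exact (isClosed_specialFiber f).closure_eq ▸ h

include hπ in
/-- In a geometrically integral family the uniformizer of the base generates a prime ideal in the
coordinate ring of each affine open subscheme that meets the special fibre. -/
theorem isPrime_span_globalFunction [GeometricallyIntegral f] {U : X.Opens} (hU : IsAffineOpen U)
    (hne : Ideal.span {X.presheaf.map (homOfLE (le_top : U ≤ ⊤)).op (globalFunction f π)} ≠ ⊤) :
    (Ideal.span {X.presheaf.map (homOfLE (le_top : U ≤ ⊤)).op (globalFunction f π)}).IsPrime := by
  let θ : CommRingCat.of R ⟶ Γ(X, U) :=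
    (Scheme.ΓSpecIso (CommRingCat.of R)).inv ≫ f.appLE ⊤ U le_top
  have hθ : Spec.map θ = hU.fromSpec ≫ f := by
    rw [← (isAffineOpen_top (Spec (CommRingCat.of R))).SpecMap_appLE_fromSpec f hU le_top,
      IsAffineOpen.fromSpec_top, Scheme.isoSpec_Spec_inv, ← Spec.map_comp]
  have hθπ : θ π = X.presheaf.map (homOfLE (le_top : U ≤ ⊤)).op (globalFunction f π) := by
    rfl
  rw [← hθπ] at hne ⊢
  let _ : Algebra R Γ(X, U) := θ.hom.toAlgebra
  let κ := R ⧸ IsLocalRing.maximalIdeal R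
  let _ : Field κ := Ideal.Quotient.field _
  have hmap : (IsLocalRing.maximalIdeal R).map (algebraMap R Γ(X, U)) = Ideal.span {θ π} := by
    rw [hπ.maximalIdeal_eq, Ideal.map_span, Set.image_singleton]
    rfl
  rw [← hmap] at hne ⊢
  -- The quotient by `π` is `Γ(X, U) ⊗ κ`, whose spectrum is an open subscheme of the fibre over
  -- `Spec κ`. That fibre is integral, and `hne` makes the open part nonempty, so the quotient is a
  -- domain.
  let e := Algebra.TensorProduct.quotIdealMapEquivTensorQuot Γ(X, U) (IsLocalRing.maximalIdeal R)
  have : Nontrivial (Γ(X, U) ⧸ (IsLocalRing.maximalIdeal R).map (algebraMap R Γ(X, U))) :=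
    Ideal.Quotient.nontrivial_iff.2 hne
  have : Nontrivial (Γ(X, U) ⊗[R] κ) := e.symm.toEquiv.nontrivial
  let q : Spec (CommRingCat.of κ) ⟶ Spec (CommRingCat.of R) :=
    Spec.map (CommRingCat.ofHom (algebraMap R κ))
  have hint : AlgebraicGeometry.IsIntegral (pullback f q) :=
    GeometricallyIntegral.geometrically_isIntegral _ _ _ (.of_hasPullback _ _)
  let i : Spec (CommRingCat.of (Γ(X, U) ⊗[R] κ)) ≅ pullback hU.fromSpec (pullback.fst f q) :=
    (pullbackSpecIso R Γ(X, U) κ).symm ≪≫ pullback.congrHom hθ rfl ≪≫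
      (pullbackRightPullbackFstIso f q hU.fromSpec).symm
  have : AlgebraicGeometry.IsIntegral (Spec (CommRingCat.of (Γ(X, U) ⊗[R] κ))) :=
    isIntegral_of_isOpenImmersion (i.hom ≫ pullback.snd _ _)
  have : IsDomain (Γ(X, U) ⊗[R] κ) := (affine_isIntegral_iff _).1 this
  have := e.toMulEquiv.isDomain
  exact (Ideal.Quotient.isDomain_iff_prime _).1 this

include hπ in
/-- At the generic point of the special fibre of a geometrically integral family, the uniformizer
of the base generates the maximal ideal of the local ring. -/
theorem maximalIdeal_stalk_eq_span [GeometricallyIntegral f] {ξ : X}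
    (hξ : IsGenericPoint ξ (specialFiber f)) :
    IsLocalRing.maximalIdeal (X.presheaf.stalk ξ) =
      Ideal.span {X.presheaf.germ ⊤ ξ trivial (globalFunction f π)} := by
  obtain ⟨_, ⟨U, hU, rfl⟩, hξU, -⟩ :=
    X.isBasis_affineOpens.exists_subset_of_mem_open (Set.mem_univ ξ) isOpen_univ
  have hU : IsAffineOpen U := hU
  let b := X.presheaf.map (homOfLE (le_top : U ≤ ⊤)).op (globalFunction f π)
  have hgerm : ∀ x (hx : x ∈ U), X.presheaf.germ U x hx b =
      X.presheaf.germ ⊤ x trivial (globalFunction f π) := fun x hx =>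
    X.presheaf.germ_res_apply _ _ _ _
  let p := hU.primeIdealOf ⟨ξ, hξU⟩
  let _ : Algebra Γ(X, U) (X.presheaf.stalk ξ) := (X.presheaf.germ U ξ hξU).hom.toAlgebra
  have hloc : IsLocalization.AtPrime (X.presheaf.stalk ξ) p.asIdeal :=
    hU.isLocalization_stalk ⟨ξ, hξU⟩
  have hbp : b ∈ p.asIdeal := by
    by_contra h
    have h1 := (IsLocalization.AtPrime.isUnit_to_map_iff (X.presheaf.stalk ξ) p.asIdeal b).2 h
    refine (mem_specialFiber_iff f hπ ξ).1 hξ.mem ?_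
    rw [← hgerm ξ hξU]
    exact h1
  have hprime := isPrime_span_globalFunction f hπ hU fun h => p.2.ne_top
    (top_le_iff.1 (h ▸ (Ideal.span_singleton_le_iff_mem _).2 hbp))
  -- The point of the prime ideal `(b)` lies on the special fibre, so it is a specialization of `ξ`;
  -- this gives `p ≤ (b)`, the nontrivial inclusion.
  let q : Spec Γ(X, U) := (⟨Ideal.span {b}, hprime⟩ : PrimeSpectrum Γ(X, U))
  have hqU : hU.fromSpec q ∈ U := by
    have : hU.fromSpec q ∈ Set.range hU.fromSpec := ⟨_, rfl⟩
    rwa [hU.range_fromSpec] at this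
  have hqZ : hU.fromSpec q ∈ specialFiber f := by
    rw [mem_specialFiber_iff f hπ, ← hgerm _ hqU]
    intro hu
    let _ : Algebra Γ(X, U) (X.presheaf.stalk (hU.fromSpec q)) :=
      (X.presheaf.germ U _ hqU).hom.toAlgebra
    have : IsLocalization.AtPrime (X.presheaf.stalk (hU.fromSpec q)) (Ideal.span {b}) :=
      hU.isLocalization_stalk' q hqU
    exact (IsLocalization.AtPrime.isUnit_to_map_iff (X.presheaf.stalk (hU.fromSpec q))
      (Ideal.span {b}) b).1 hu (Ideal.mem_span_singleton_self b)
  have hspec : hU.fromSpec p ⤳ hU.fromSpec q := by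
    rw [hU.fromSpec_primeIdealOf]
    exact hξ.specializes hqZ
  have hle : p.asIdeal ≤ Ideal.span {b} := (PrimeSpectrum.le_iff_specializes p q).2
    (hU.fromSpec.isOpenEmbedding.isInducing.specializes_iff.1 hspec)
  have hpb : p.asIdeal = Ideal.span {b} :=
    le_antisymm hle ((Ideal.span_singleton_le_iff_mem _).2 hbp)
  rw [← IsLocalization.AtPrime.map_eq_maximalIdeal p.asIdeal, hpb, Ideal.map_span,
    Set.image_singleton, ← hgerm ξ hξU]
  rfl

variable [AlgebraicGeometry.IsIntegral X] [IsLocallyNoetherian X]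

-- The maximal ideal is generated by `π`, whose germ is nonzero because it becomes a unit at the
-- generic point of `X`, which is off the special fibre.
include hπ in
theorem isDiscreteValuationRing_stalk_of_isGenericPoint [GeometricallyIntegral f] {ξ : X}
    (hξ : IsGenericPoint ξ (specialFiber f)) (hg : genericPoint X ∉ specialFiber f) :
    IsDiscreteValuationRing (X.presheaf.stalk ξ) ∧
      Irreducible (X.presheaf.germ ⊤ ξ trivial (globalFunction f π)) := by
  have hmax := maximalIdeal_stalk_eq_span f hπ hξ
  have hne : X.presheaf.germ ⊤ ξ trivial (globalFunction f π) ≠ 0 := by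
    intro h0
    rw [mem_specialFiber_iff f hπ, not_not] at hg
    have h1 := X.presheaf.germ_stalkSpecializes_apply (U := ⊤) trivial
      ((genericPoint_spec X).specializes trivial : genericPoint X ⤳ ξ) (globalFunction f π)
    rw [h0, map_zero] at h1
    exact hg.ne_zero h1.symm
  have hf : ¬ IsField (X.presheaf.stalk ξ) := fun h => by
    rw [IsLocalRing.isField_iff_maximalIdeal_eq, hmax, Ideal.span_singleton_eq_bot] at h
    exact hne h
  have h04 := (IsDiscreteValuationRing.TFAE (X.presheaf.stalk ξ) hf).out 0 4
  refine ⟨h04.2 ⟨_, hmax⟩, ?_⟩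
  exact IsDiscreteValuationRing.irreducible_of_span_eq_maximalIdeal _ hne hmax

include hπ in
theorem coheight_eq_one_of_isGenericPoint [GeometricallyIntegral f] {ξ : X}
    (hξ : IsGenericPoint ξ (specialFiber f)) (hg : genericPoint X ∉ specialFiber f) :
    Order.coheight ξ = 1 := by
  have := (isDiscreteValuationRing_stalk_of_isGenericPoint f hπ hξ hg).1
  have h := ringKrullDim_stalk_eq_coheight ξ
  rw [IsDiscreteValuationRing.ringKrullDim_eq_one] at h
  exact (WithBot.coe_injective h).symm

end SpecialFiber

/-! ### Birational transforms and their generic points. -/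

theorem bijective_stalkMap_of_isOpenImmersion {X Y : Scheme.{u}} (g : Y ⟶ X) (V : Y.Opens) (y : Y)
    (hy : y ∈ V) [IsOpenImmersion (V.ι ≫ g)] : Function.Bijective (g.stalkMap y) := by
  let v : V.toScheme := ⟨y, hy⟩
  have h1 : Function.Bijective ((V.ι ≫ g).stalkMap v) := ConcreteCategory.bijective_of_isIso _
  have h2 : Function.Bijective (V.ι.stalkMap v) := ConcreteCategory.bijective_of_isIso _
  rw [Scheme.Hom.stalkMap_comp] at h1
  exact (Function.Bijective.of_comp_iff' h2 (g.stalkMap (V.ι v))).1 h1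

/-- The strict transform of an irreducible closed subset `Z` is irreducible, and the morphism is an
isomorphism near its generic point, which maps to the generic point of `Z`. -/
theorem isGenericPoint_of_birationalTransform {X Y : Scheme.{u}} (ρ : Y ⟶ X) {Z : Set X}
    (hZ : IsClosed Z) {ξ : X} (hξ : IsGenericPoint ξ Z) {E : Y}
    (hE : IsGenericPoint E (birationalTransform ρ Z)) :
    IsGenericPoint (ρ E) Z ∧ Function.Bijective (ρ.stalkMap E) := by
  have hEZ : ρ E ∈ Z := by
    have hsub : birationalTransform ρ Z ⊆ ρ ⁻¹' Z :=
      closure_minimal (fun y hy => hy.2) (hZ.preimage ρ.continuous)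
    exact hsub hE.mem
  obtain ⟨s, ⟨V, hsV, hV⟩, hsZ⟩ : Set.Nonempty
      {y | (∃ V : Y.Opens, y ∈ V ∧ IsOpenImmersion (V.ι ≫ ρ)) ∧ ρ y ∈ Z} := by
    rw [← closure_nonempty_iff]
    exact ⟨E, hE.mem⟩
  -- Open sets are stable under generization, and `E` specializes to `s ∈ V`. The same argument puts
  -- `ξ` in the open image of `V`.
  have hEV : E ∈ V := (hE.specializes (subset_closure ⟨⟨V, hsV, hV⟩, hsZ⟩)).mem_open V.2 hsV
  refine ⟨?_, bijective_stalkMap_of_isOpenImmersion ρ V E hEV⟩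
  obtain ⟨w, hw⟩ : ξ ∈ Set.range (V.ι ≫ ρ) :=
    (hξ.specializes hEZ).mem_open (V.ι ≫ ρ).isOpenEmbedding.isOpen_range ⟨⟨E, hEV⟩, rfl⟩
  have hw' : ρ w.1 = ξ := hw
  have hEw : E ⤳ w.1 := hE.specializes (subset_closure ⟨⟨V, w.2, hV⟩, hw' ▸ hξ.mem⟩)
  have h1 : ρ E ⤳ ξ := hw' ▸ hEw.map ρ.continuous
  rw [(h1.antisymm (hξ.specializes hEZ)).eq]
  exact hξ

/-! ### Comparing two models through a birational map. -/

section PartialIso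

variable {X X' Y : Scheme.{u}} [IsIntegral X] [IsIntegral X'] [IsIntegral Y]

/-- If `ρ' = α ∘ ρ` as rational maps, then the pullbacks of rational functions agree. -/
theorem functionFieldMap_comp_inverseFunctionFieldMap (α : X.PartialIso X') (ρ : Y ⟶ X)
    (ρ' : Y ⟶ X') [IsDominant ρ] [IsDominant ρ']
    (h : (ρ ∣_ α.source) ≫ α.iso.hom ≫ α.target.ι = (ρ ⁻¹ᵁ α.source).ι ≫ ρ') :
    (functionFieldMap ρ').comp (inverseFunctionFieldMap α) = functionFieldMap ρ := by
  have hnt : Nonempty α.target := α.dense_target.nonempty.to_subtype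
  have hns : Nonempty α.source := α.dense_source.nonempty.to_subtype
  have hW : Dense ((ρ ⁻¹ᵁ α.source : Y.Opens) : Set Y) := by
    refine (ρ ⁻¹ᵁ α.source).isOpen.dense ?_
    obtain ⟨y, hy⟩ := ρ.denseRange.exists_mem_open α.source.isOpen α.dense_source.nonempty
    exact ⟨y, hy⟩
  have hnW : Nonempty (ρ ⁻¹ᵁ α.source) := hW.nonempty.to_subtype
  have : IsDominant α.source.ι := Opens.isDominant_ι α.dense_source
  have : IsDominant α.target.ι := Opens.isDominant_ι α.dense_target
  have : IsDominant (ρ ⁻¹ᵁ α.source).ι := Opens.isDominant_ι hW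
  have : IsDominant ((ρ ∣_ α.source) ≫ α.source.ι) := by
    rw [morphismRestrict_ι]; infer_instance
  have : IsDominant (ρ ∣_ α.source) := IsDominant.of_comp_of_isOpenImmersion _ α.source.ι
  ext x
  -- Rational functions may be compared on the dense open preimage of `α.source`, where `h` is an
  -- equality of morphisms.
  apply (functionFieldMap (ρ ⁻¹ᵁ α.source).ι).injective
  have e1 := congr($(functionFieldMap_comp (ρ ⁻¹ᵁ α.source).ι ρ') (inverseFunctionFieldMap α x))
  have e2 := congr($(functionFieldMap_comp (ρ ⁻¹ᵁ α.source).ι ρ) x)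
  have e3 := congr($(functionFieldMap_comp (ρ ∣_ α.source ≫ α.iso.hom) α.target.ι)
    (inverseFunctionFieldMap α x))
  have e4 := congr($(functionFieldMap_comp (ρ ∣_ α.source ≫ α.iso.hom)
    (α.iso.inv ≫ α.source.ι)) x)
  have e5 := functionFieldMap_congr (h.symm.trans (Category.assoc _ _ _).symm)
  have e6 : (ρ ∣_ α.source ≫ α.iso.hom) ≫ α.iso.inv ≫ α.source.ι = (ρ ⁻¹ᵁ α.source).ι ≫ ρ := by
    rw [← morphismRestrict_ι]; simp
  simp only [RingHom.comp_apply] at e1 e2 e3 e4 ⊢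
  rw [← e1, ← e2, e5, e3, functionFieldMap_inverseFunctionFieldMap, ← e4,
    functionFieldMap_congr e6]

variable [IsLocallyNoetherian X] [IsLocallyNoetherian X'] {F : Type*} [Field F]

/-- Points of the target of a birational map correspond to points of the source with the same
codimension, the same order of vanishing and the same canonical divisor. -/
theorem exists_point_of_mem_target (hn : ∀ x : X, IsIntegrallyClosed (X.presheaf.stalk x))
    (hn' : ∀ x : X', IsIntegrallyClosed (X'.presheaf.stalk x)) (α : X.PartialIso X')
    (φ : F →+* X.functionField) (k : Type*) [Field k] [Algebra k F] (z : X') (hz : z ∈ α.target) :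
    ∃ x : α.source.toScheme, α.target.ι (α.iso.hom x) = z ∧
      Order.coheight (α.source.ι x) = Order.coheight z ∧
      (∀ g, Scheme.ord (inverseFunctionFieldMap α (φ g)) z = Scheme.ord (φ g) (α.source.ι x)) ∧
      ∀ ω, canonicalDivisor ((inverseFunctionFieldMap α).comp φ) k ω z =
        canonicalDivisor φ k ω (α.source.ι x) := by
  have hnt : Nonempty α.target := α.dense_target.nonempty.to_subtype
  have : IsDominant α.source.ι := Opens.isDominant_ι α.dense_source
  have : IsDominant α.target.ι := Opens.isDominant_ι α.dense_target
  have : IsLocallyNoetherian α.target.toScheme :=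
    isLocallyNoetherian_of_isOpenImmersion α.target.ι
  let w : α.target.toScheme := ⟨z, hz⟩
  have hw : α.iso.hom (α.iso.inv w) = w := by simp
  have hb : Function.Bijective ((α.iso.inv ≫ α.source.ι).stalkMap w) :=
    ConcreteCategory.bijective_of_isIso _
  have hb' : Function.Bijective (α.target.ι.stalkMap w) := ConcreteCategory.bijective_of_isIso _
  have hφ : (functionFieldMap α.target.ι).comp ((inverseFunctionFieldMap α).comp φ) =
      (functionFieldMap (α.iso.inv ≫ α.source.ι)).comp φ := by
    ext g
    exact functionFieldMap_inverseFunctionFieldMap α (φ g)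
  refine ⟨α.iso.inv w, by rw [hw]; rfl, ?_, fun g => ?_, fun ω => ?_⟩
  · exact (coheight_eq_of_bijective_stalkMap _ w hb).trans
      (coheight_eq_of_bijective_stalkMap _ w hb').symm
  · have e1 := ord_functionFieldMap _ w hb' (hn' _) (inverseFunctionFieldMap α (φ g))
    have e2 := ord_functionFieldMap _ w hb (hn _) (φ g)
    rw [functionFieldMap_inverseFunctionFieldMap] at e1
    exact e1.symm.trans e2
  · have e1 := canonicalDivisor_functionFieldMap ((inverseFunctionFieldMap α).comp φ) ω _ w hb'
      (hn' _)
    have e2 := canonicalDivisor_functionFieldMap φ ω _ w hb (hn _)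
    rw [hφ] at e1
    exact e1.symm.trans e2

end PartialIso

/-! ### Elements of the base ring as rational functions. -/

section StructureMap

variable {R : Type u} [CommRing R] {X X' : Scheme.{u}} [IsIntegral X] [IsIntegral X']
  (f : X ⟶ Spec (CommRingCat.of R)) (f' : X' ⟶ Spec (CommRingCat.of R))

theorem algebraMap_germ_globalFunction [IsLocalRing R] (x : X) (a : R) :
    algebraMap (X.presheaf.stalk x) X.functionField
      (X.presheaf.germ ⊤ x trivial (globalFunction f a)) =
      FunctionField.toFunctionField f (FunctionField.structureMap f a) := by
  have : Nonempty (⊤ : X.Opens) := ⟨⟨genericPoint X, trivial⟩⟩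
  exact Scheme.algebraMap_germ_eq_germToFunctionField X (U := ⊤) (x := x) trivial _

/-- As `α` is a map over `Spec R`, both sides restrict on `α.target` to the same global function. -/
theorem toFunctionFieldOfBirational_structureMap [IsLocalRing R] (α : X.PartialIso X')
    (hα : α.IsOver f f') (a : R) :
    FunctionField.toFunctionFieldOfBirational f α (FunctionField.structureMap f a) =
      FunctionField.toFunctionField f' (FunctionField.structureMap f' a) := by
  have hnt : Nonempty α.target := α.dense_target.nonempty.to_subtype
  have : IsDominant α.source.ι := Opens.isDominant_ι α.dense_source
  have : IsDominant α.target.ι := Opens.isDominant_ι α.dense_target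
  have : Nonempty (⊤ : X.Opens) := ⟨⟨genericPoint X, trivial⟩⟩
  have : Nonempty (⊤ : X'.Opens) := ⟨⟨genericPoint X', trivial⟩⟩
  have : Nonempty (⊤ : α.target.toScheme.Opens) := ⟨⟨genericPoint α.target, trivial⟩⟩
  apply (functionFieldMap α.target.ι).injective
  refine (functionFieldMap_inverseFunctionFieldMap α _).trans ?_
  refine (functionFieldMap_germToFunctionField (α.iso.inv ≫ α.source.ι)
    (globalFunction f a)).trans ?_
  refine Eq.trans ?_ (functionFieldMap_germToFunctionField α.target.ι (globalFunction f' a)).symm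
  have hover : (α.iso.inv ≫ α.source.ι) ≫ f = α.target.ι ≫ f' := by
    rw [Category.assoc, ← hα, Iso.inv_hom_id_assoc]
  rw [← globalFunction_comp, ← globalFunction_comp, hover]

end StructureMap

end FamilyOfPairs

/-! ### Comparison of the two filtrations. -/

open FamilyOfPairs
theorem proposition3p7
    {k : Type*} [Field k] [CharZero k]
    {R : Type u} [CommRing R] [IsDomain R] [IsDiscreteValuationRing R]
    [Algebra k R] [Algebra.EssFiniteType k R]
    (π : R) (hπ : Irreducible π)
    {X X' Y : Scheme.{u}} [IsIntegral X] [IsIntegral X'] [IsIntegral Y]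
    [IsLocallyNoetherian X] [IsLocallyNoetherian X'] [IsLocallyNoetherian Y]
    (f : X ⟶ Spec (CommRingCat.of R)) (f' : X' ⟶ Spec (CommRingCat.of R))
    (D : AlgebraicCycle X ℚ) (D' : AlgebraicCycle X' ℚ)
    (hf : IsFamilyOfPairs f D) (hf' : IsFamilyOfPairs f' D')
    (α : X.PartialIso X') (hα : IsGenericFiberIso f f' D D' α)
    (hY : ∀ y : Y, IsIntegrallyClosed (Y.presheaf.stalk y))
    (ρ : Y ⟶ X) (ρ' : Y ⟶ X') [IsProper ρ] [IsProper ρ']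
    [IsBirationalMorphism ρ] [IsBirationalMorphism ρ']
    (hρ : ρ ≫ f = ρ' ≫ f')
    (hρα : (ρ ∣_ α.source) ≫ α.iso.hom ≫ α.target.ι = (ρ ⁻¹ᵁ α.source).ι ≫ ρ')
    (E : Y) (hE : IsGenericPoint E (birationalTransform ρ' (specialFiber f')))
    (ω : RationalTopForm k (FunctionField f)) (hω : ω ≠ 0)
    (r : ℕ) (hr : 0 < r)
    (hL : IsCartierDivisor
      (antiLogCanonical (FunctionField.toFunctionField f) ω D r 1))
    (hL' : IsCartierDivisor
      (antiLogCanonical (FunctionField.toFunctionFieldOfBirational f α) ω D' r 1)) :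
    ∃ c : ℤ,
      (c : ℚ) = (r : ℚ) * discrepancy (FunctionField.toFunctionField f) ω ρ D E ∧
      ∀ (p : ℤ) (m : ℕ),
        vanishingFiltration (FunctionField.toFunctionField f) ρ
            (antiLogCanonical (FunctionField.toFunctionField f) ω D r m) E (p + (m : ℤ) * c) =
          antiLogSections (FunctionField.toFunctionField f) ω D r m ∩
            {g | ∃ g' ∈ antiLogSections (FunctionField.toFunctionFieldOfBirational f α) ω D' r m,
              g = FunctionField.structureMap f π ^ p * g'} := by
  have hn := hf.normal
  have hn' := hf'.normal
  have hgi := hf'.geometricallyIntegral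
  obtain ⟨ξ, hξ⟩ := exists_isGenericPoint_specialFiber f'
  obtain ⟨hξE, hbij⟩ := isGenericPoint_of_birationalTransform ρ' (isClosed_specialFiber f') hξ hE
  obtain rfl : ρ' E = ξ := hξE.eq hξ
  have hmem : ∀ z : X', z ∉ specialFiber f' → z ∈ α.target := fun z hz => by
    rw [← SetLike.mem_coe, hα.target_eq]
    exact hz
  have hgen : genericPoint X' ∉ specialFiber f' := by
    have : genericPoint X' ∈ (α.target : Set X') :=
      ((genericPoint_spec X').mem_open_set_iff α.target.2).2
        (by simpa using α.dense_target.nonempty)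
    rwa [hα.target_eq] at this
  obtain ⟨hdvr, hirr⟩ := isDiscreteValuationRing_stalk_of_isGenericPoint f' hπ hξ hgen
  have hcoh := coheight_eq_one_of_isGenericPoint f' hπ hξ hgen
  -- A point of the fibre other than its generic point is a strict specialization of it, so its
  -- codimension exceeds one.
  have hpt : ∀ z ∈ specialFiber f', Order.coheight z = 1 → z = ρ' E := by
    intro z hz hz1
    have hle : z ≤ ρ' E := Scheme.le_iff_specializes.2 (hξ.specializes hz)
    by_contra hne
    have hlt : z < ρ' E := lt_of_le_not_ge hle fun h =>
      hne (((Scheme.le_iff_specializes.1 h).antisymm (Scheme.le_iff_specializes.1 hle)).eq)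
    have := Order.coheight_add_one_le hlt
    rw [hcoh, hz1] at this
    norm_num at this
  have hD' : D' (ρ' E) = 0 := by
    by_contra h
    refine hf'.fiber_not_subset (IsLocalRing.closedPoint R) ?_
    have : specialFiber f' ⊆ closure {x : X' | D' x ≠ 0} := by
      rw [← hξ.def]
      exact closure_mono (Set.singleton_subset_iff.2 h)
    exact this
  let φ := FunctionField.toFunctionField f
  let φ' := FunctionField.toFunctionFieldOfBirational f α
  have hφ : (functionFieldMap ρ').comp φ' = (functionFieldMap ρ).comp φ := by
    rw [← functionFieldMap_comp_inverseFunctionFieldMap α ρ ρ' hρα]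
    rfl
  have hordE : ∀ g, Scheme.ord (functionFieldMap ρ (φ g)) E = Scheme.ord (φ' g) (ρ' E) := by
    intro g
    rw [← ord_functionFieldMap ρ' E hbij (hn' _)]
    exact congrArg (fun x => Scheme.ord x E) congr($hφ g).symm
  have hKE : canonicalDivisor ((functionFieldMap ρ).comp φ) k ω E =
      canonicalDivisor φ' k ω (ρ' E) := by
    rw [← hφ]
    exact canonicalDivisor_functionFieldMap φ' ω ρ' E hbij (hn' _)
  set ϖ := FunctionField.structureMap f π with hϖ
  have hφϖ : ∀ z : X', φ' ϖ = algebraMap (X'.presheaf.stalk z) X'.functionField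
      (X'.presheaf.germ ⊤ z trivial (globalFunction f' π)) := fun z => by
    rw [algebraMap_germ_globalFunction f' z π]
    exact toFunctionFieldOfBirational_structureMap f f' α hα.isOver π
  have hϖE : Scheme.ord (φ' ϖ) (ρ' E) = 1 := by
    rw [hφϖ (ρ' E)]
    exact ord_algebraMap_of_irreducible _ hcoh _ hirr
  have hϖz : ∀ z ∉ specialFiber f', Scheme.ord (φ' ϖ) z = 0 := fun z hz => by
    rw [hφϖ z]
    refine ord_algebraMap_of_isUnit z _ ?_
    by_contra h
    exact hz ((mem_specialFiber_iff f' hπ z).2 h)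
  have hϖ0 : ϖ ≠ 0 := fun h => by
    rw [h, map_zero] at hϖE
    simp at hϖE
  have hord : ∀ (p : ℤ) (g : FunctionField f) (z : X'), g ≠ 0 →
      Scheme.ord (φ' (ϖ ^ p * g)) z = p * Scheme.ord (φ' ϖ) z + Scheme.ord (φ' g) z := by
    intro p g z hg
    have h1 : φ' ϖ ≠ 0 := (map_ne_zero φ').2 hϖ0
    rw [map_mul, map_zpow₀, Scheme.ord_mul (zpow_ne_zero _ h1) ((map_ne_zero φ').2 hg),
      ord_zpow z h1]
  -- One local equation `h` of `L` serves for all `m`: `h ^ m` is an equation of `mL`, and `h⁻¹` one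
  -- of `r(K_X + D)`.
  obtain ⟨h, hh⟩ := hL (ρ E)
  set e : ℤ := Scheme.ord (functionFieldMap ρ h) E with he
  set κ : ℤ := canonicalDivisor φ' k ω (ρ' E) with hκ
  have hr0 : (r : ℚ) ≠ 0 := by exact_mod_cast hr.ne'
  have hpull : pullbackCoeff ρ (logCanonical φ ω D) E = -e / r := by
    have h1 := hh.inv
    have h2 : (fun z => -antiLogCanonical φ ω D r 1 z) =
        fun z => (r : ℚ) * logCanonical φ ω D z := by
      ext z; simp [antiLogCanonical]
    rw [h2] at h1
    rw [pullbackCoeff_eq hn ρ E hr h1, map_inv₀, ord_inv _ ((map_ne_zero _).2 hh.1), Int.cast_neg]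
  have hpullm : ∀ m : ℕ, pullbackCoeff ρ (antiLogCanonical φ ω D r m) E = m * e := by
    intro m
    have h1 := hh.pow m
    have h2 : (fun z => (m : ℚ) * antiLogCanonical φ ω D r 1 z) =
        fun z => ((1 : ℕ) : ℚ) * antiLogCanonical φ ω D r m z := by
      ext z; simp only [antiLogCanonical]; push_cast; ring
    rw [h2] at h1
    rw [pullbackCoeff_eq hn ρ E one_pos h1, map_pow, ord_pow _ ((map_ne_zero _).2 hh.1)]
    push_cast
    ring
  -- `r a = r (κ - (-e / r))`.
  refine ⟨r * κ + e, ?_, fun p m => ?_⟩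
  · rw [discrepancy, hKE, hpull]
    push_cast
    field_simp
    ring
  have hDE : antiLogCanonical φ' ω D' r m (ρ' E) = -(m * r * κ) := by
    rw [antiLogCanonical, logCanonical, hD', add_zero]
  -- The contribution `me` of `ρ^*(mL)` cancels against the one in `mra`.
  have hstep : ∀ g, ((p + (m : ℤ) * (r * κ + e) : ℤ) : ℚ) ≤
      sectionOrder φ ρ (antiLogCanonical φ ω D r m) E g ↔
      p + m * r * κ ≤ Scheme.ord (φ' g) (ρ' E) := by
    intro g
    rw [sectionOrder, hpullm, hordE, ← Int.cast_natCast (R := ℚ) m, ← Int.cast_mul,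
      ← Int.cast_add, Int.cast_le]
    constructor <;> intro h <;> linarith
  ext g
  constructor
  · rintro ⟨hg, hgp⟩
    refine ⟨hg, ϖ ^ (-p) * g, fun hg' z hz => ?_, ?_⟩
    · have hg0 : g ≠ 0 := right_ne_zero_of_mul hg'
      change 0 ≤ (Scheme.ord (φ' (ϖ ^ (-p) * g)) z : ℚ) + antiLogCanonical φ' ω D' r m z
      rw [hord _ _ _ hg0]
      by_cases hzs : z ∈ specialFiber f'
      · obtain rfl := hpt z hzs hz
        have h1 := (hstep g).1 (hgp hg0)
        rw [hDE, hϖE]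
        have h2 : ((p + m * r * κ : ℤ) : ℚ) ≤ (Scheme.ord (φ' g) (ρ' E) : ℚ) :=
          Int.cast_le.2 h1
        push_cast at h2 ⊢
        linarith
      · obtain ⟨x, hx, hxc, hxo, hxK⟩ := exists_point_of_mem_target hn hn' α φ k z (hmem z hzs)
        have h1 := hg hg0 (α.source.ι x) (hxc.trans hz)
        rw [hϖz z hzs, mul_zero, zero_add]
        have h2 : antiLogCanonical φ' ω D' r m z =
            antiLogCanonical φ ω D r m (α.source.ι x) := by
          have h3 : D' z = D (α.source.ι x) := hx ▸ hα.map_divisor x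
          have h4 : canonicalDivisor φ' k ω z = canonicalDivisor φ k ω (α.source.ι x) := hxK ω
          simp only [antiLogCanonical, logCanonical, h3, h4]
        have h5 : Scheme.ord (φ' g) z = Scheme.ord (φ g) (α.source.ι x) := hxo g
        rw [h2, h5]
        exact h1
    · rw [← mul_assoc, ← zpow_add₀ hϖ0, add_neg_cancel, zpow_zero, one_mul]
  · rintro ⟨hg, g', hg', rfl⟩
    refine ⟨hg, fun hg0 => (hstep _).2 ?_⟩
    have hg'0 : g' ≠ 0 := right_ne_zero_of_mul hg0
    have h1 : 0 ≤ (Scheme.ord (φ' g') (ρ' E) : ℚ) + antiLogCanonical φ' ω D' r m (ρ' E) :=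
      hg' hg'0 (ρ' E) hcoh
    rw [hDE] at h1
    have h2 : ((m * r * κ : ℤ) : ℚ) ≤ (Scheme.ord (φ' g') (ρ' E) : ℚ) := by
      push_cast
      linarith
    rw [hord _ _ _ hg'0, hϖE]
    have h3 := Int.cast_le.1 h2
    linarith
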